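/- Fix a real number $\theta>0$. For an integer $N\ge 1$ let $\sigma$ be an Ewens random permutation of $\{1,\dots,N\}$ with parameter $\theta$, that is, $$\mathbb{P}(\sigma=\pi)=\frac{\theta^{\#(\pi)}}{\theta(\theta+1)\cdots(\theta+N-1)},$$ where $\#(\pi)$ is the number of cycles of $\pi$ (fixed points included). For $k\in\{0,1,\dots,N\}$ put $$F^{(N)}_\sigma(k/N)=\frac1N\,\#\{i : 1\le i\le k,\ \sigma(i)\ge i\},$$ and extend $F^{(N)}_\sigma$ to $[0,1]$ so that it is affine on each interval $[k/N,(k+1)/N]$, $0\le k\le N-1$. For bounded random variables $X_1,\dots,X_\ell$ on the same probability space let $\kappa(X_1,\dots,X_\ell)$ be their joint cumulant, that is, the coefficient of $t_1\cdots t_\ell$ in the power series expansion at $0$ of $\ln \mathbb{E}\big(\exp(t_1X_1+\dots+t_\ell X_\ell)\big)$. For every integer $\ell\ge 1$ there exists a constant $C''_\ell$ (depending only on $\ell$ and $\theta$) such that, for every integer $N\ge 1$ and all real numbers $x_1,\dots,x_\ell\in[0,1]$, $$\big|\kappa\big(F^{(N)}_\sigma(x_1),\dots,F^{(N)}_\sigma(x_\ell)\big)\big|\le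 C''_\ell\, N^{-\ell+1}.$$ -/

import Mathlib

open MeasureTheory

noncomputable section

/-- The permutation group of a finite set carries the discrete sigma-algebra. -/
instance permMeasurableSpace (N : ℕ) : MeasurableSpace (Equiv.Perm (Fin N)) := ⊤

/-- The number of cycles of a permutation of `Fin N`, fixed points included. -/
def numCycles {N : ℕ} (σ : Equiv.Perm (Fin N)) : ℕ := Multiset.card σ.partition.parts

/-- The Ewens probability of a single permutation,
`θ ^ (number of cycles) / (θ (θ + 1) ⋯ (θ + N - 1))`. -/
def ewensWeight (θ : ℝ) {N : ℕ} (σ : Equiv.Perm (Fin N)) : ℝ :=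
  θ ^ numCycles σ / ∏ i ∈ Finset.range N, (θ + (i : ℝ))

/-- The Ewens measure with parameter `θ` on the permutations of `Fin N`. -/
def ewensMeasure (θ : ℝ) (N : ℕ) : Measure (Equiv.Perm (Fin N)) :=
  ∑ σ : Equiv.Perm (Fin N), ENNReal.ofReal (ewensWeight θ σ) • Measure.dirac σ

/-- The joint cumulant of `X 0, …, X (ℓ - 1)`: the coefficient of `t_0 ⋯ t_(ℓ - 1)` in the Taylor
expansion at `0` of `t ↦ log (E (exp (∑ i, t_i X_i)))`. As each variable has degree one in this
monomial, the coefficient is the mixed partial derivative `∂/∂t_0 ⋯ ∂/∂t_(ℓ - 1)` at `0`. -/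
def jointCumulant {Ω : Type*} [MeasurableSpace Ω] (μ : Measure Ω) {ℓ : ℕ} (X : Fin ℓ → Ω → ℝ) : ℝ :=
  iteratedFDeriv ℝ ℓ
    (fun t : Fin ℓ → ℝ => Real.log (∫ ω, Real.exp (∑ i, t i * X i ω) ∂μ))
    0 (fun i => Pi.single i (1 : ℝ))

/-- The indicator of the event that `i` is a weak exceedance of `σ`, that is `σ i ≥ i`. (The order
comparison does not depend on whether the elements are numbered from `0` or from `1`.) -/
def excInd {N : ℕ} (σ : Equiv.Perm (Fin N)) (i : Fin N) : ℝ := if i ≤ σ i then 1 else 0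

/-- The number of weak exceedances among the first `k` elements. -/
def excCount {N : ℕ} (σ : Equiv.Perm (Fin N)) (k : ℕ) : ℝ :=
  ∑ i ∈ Finset.univ.filter (fun i : Fin N => (i : ℕ) < k), excInd σ i

/-- The function `F` on `[0, 1]` attached to a permutation `σ` of size `N`: its value at `k / N` is
`excCount σ k / N` for `k = 0, …, N`, and it is affine between `k / N` and `(k + 1) / N`. -/
def excF {N : ℕ} (σ : Equiv.Perm (Fin N)) (x : ℝ) : ℝ :=
  (excCount σ ⌊(N : ℝ) * x⌋₊ + ((N : ℝ) * x - (⌊(N : ℝ) * x⌋₊ : ℝ)) *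
    (excCount σ (⌊(N : ℝ) * x⌋₊ + 1) - excCount σ ⌊(N : ℝ) * x⌋₊)) / (N : ℝ)

end

/-! The generating function of permutations, with weight `θ` per cycle, `x i` per weak exceedance
source and `y j` per anti-exceedance target, has no zeros when all variables have positive real part
(`eulerianSum_ne_zero`). Inserting a new smallest element gives `A ↦ θ x₀ A + x₀ y₀ ∂A`, with `∂`
the sum of all partial derivatives. The result is `x₀ y₀ A (θ / y₀ + ∂A / A)`; the last factor has
positive real part, since `∂A / A` is the logarithmic derivative of a polynomial whose roots lie in
the left half-plane.

Setting `x i = exp (z b i)`, `y = 1` shows that the Laplace transform of `∑ b i * excInd σ i` has no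
zeros for `‖z‖ |b i| ≤ 1`. For a sum of at most `ℓ` values of `F`, `|b i| ≤ ℓ / N`, so its logarithm
is holomorphic on a disc of radius `N / ℓ`, with real part at most `N`. Borel–Carathéodory and
Cauchy (`abs_iteratedDeriv_log_norm_le`) bound the `ℓ`-th derivative at `0` by a constant times `N /
N ^ ℓ`. Polarization passes to joint cumulants. -/

/-! ### Cycle counts when a smallest element is inserted -/

theorem numCycles_eq {N : ℕ} (σ : Equiv.Perm (Fin N)) :
    numCycles σ = Multiset.card σ.cycleType + (N - σ.support.card) := by
  simp [numCycles, Equiv.Perm.parts_partition]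

theorem decomposeFin_symm_zero_eq_extendDomain {n : ℕ} (e : Equiv.Perm (Fin n)) :
    Equiv.Perm.decomposeFin.symm (0, e) =
      e.extendDomain (finSuccAboveEquiv (0 : Fin (n + 1))) := by
  ext i
  refine Fin.cases ?_ (fun i => ?_) i
  · rw [Equiv.Perm.extendDomain_apply_not_subtype _ _ (by simp)]
    simp
  · have h := Equiv.Perm.extendDomain_apply_image e (finSuccAboveEquiv (0 : Fin (n + 1))) i
    simp only [finSuccAboveEquiv_apply, Fin.zero_succAbove] at h
    rw [h]
    simp

theorem decomposeFin_symm_eq_swap_mul {n : ℕ} (p : Fin (n + 1)) (e : Equiv.Perm (Fin n)) :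
    Equiv.Perm.decomposeFin.symm (p, e) =
      Equiv.swap 0 p * Equiv.Perm.decomposeFin.symm (0, e) := by
  ext i
  refine Fin.cases ?_ (fun i => ?_) i <;> simp

/-- Multiplying by a transposition that joins a fixed point `a` to a cycle lengthens that cycle
by one. -/
theorem isCycle_swap_mul {α : Type*} [Fintype α] [DecidableEq α] {c : Equiv.Perm α} {a p : α}
    (hc : c.IsCycle) (hp : c p ≠ p) (ha : c a = a) :
    (Equiv.swap a p * c).IsCycle ∧ (Equiv.swap a p * c).support = insert a c.support := by
  have hl : c.toList p = p :: (c.toList p).tail := by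
    have h2 := Equiv.Perm.toList_getElem_zero c p (Equiv.Perm.mem_support.2 hp)
    cases h : c.toList p with
    | nil =>
      rw [Equiv.Perm.toList_eq_nil_iff] at h
      exact absurd (Equiv.Perm.mem_support.2 hp) h
    | cons b l =>
      simp only [h] at h2
      simpa using h2
  have hf : (c.toList p).formPerm = c := by
    rw [Equiv.Perm.formPerm_toList, hc.cycleOf_eq hp]
  have hmem : ∀ b, b ∈ c.toList p ↔ b ∈ c.support := by
    intro b
    rw [Equiv.Perm.mem_toList_iff]
    constructor
    · rintro ⟨h1, h2⟩
      exact (h1.mem_support_iff).1 h2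
    · intro h
      exact ⟨hc.sameCycle hp (Equiv.Perm.mem_support.1 h), Equiv.Perm.mem_support.2 hp⟩
  have hnd : (a :: c.toList p).Nodup := by
    rw [List.nodup_cons]
    exact ⟨fun h => by simpa [ha] using (hmem a).1 h, Equiv.Perm.nodup_toList _ _⟩
  -- Listing the cycle from `p` makes left multiplication by the transposition a mere prepending of
  -- `a`.
  have hsw : Equiv.swap a p * c = (a :: c.toList p).formPerm := by
    conv_lhs => rw [← hf]
    rw [hl, List.formPerm_cons_cons]
  have hlen : 2 ≤ (a :: c.toList p).length := by
    rw [hl]; simp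
  refine ⟨hsw ▸ List.isCycle_formPerm hnd hlen, ?_⟩
  rw [hsw, List.support_formPerm_of_nodup _ hnd]
  · ext b
    simp [hmem]
  · intro x hx
    rw [hl] at hx
    simp at hx

theorem numCycles_decomposeFin_symm_zero {n : ℕ} (e : Equiv.Perm (Fin n)) :
    numCycles (Equiv.Perm.decomposeFin.symm (0, e)) = numCycles e + 1 := by
  rw [numCycles_eq, numCycles_eq, decomposeFin_symm_zero_eq_extendDomain,
    Equiv.Perm.cycleType_extendDomain, Equiv.Perm.card_support_extend_domain]
  have := Finset.card_le_univ e.support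
  simp at this
  omega

/-- The fixed point `a` is absorbed into the cycle of `p`. If `p` is fixed too, a new 2-cycle
replaces two fixed points; otherwise only the factor `c` through `p` changes. -/
theorem numCycles_swap_mul {N : ℕ} {σ : Equiv.Perm (Fin N)} {a p : Fin N} (hap : a ≠ p)
    (ha : σ a = a) : numCycles (Equiv.swap a p * σ) + 1 = numCycles σ := by
  rw [numCycles_eq, numCycles_eq]
  by_cases hp : σ p = p
  · have hd : (Equiv.swap a p).Disjoint σ := by
      intro x
      by_cases h1 : x = a
      · right; rw [h1, ha]
      by_cases h2 : x = p
      · right; rw [h2, hp]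
      · left; exact Equiv.swap_apply_of_ne_of_ne h1 h2
    have hle := Finset.card_le_univ (Equiv.swap a p * σ).support
    rw [hd.card_support_mul] at hle ⊢
    rw [hd.cycleType_mul, (Equiv.Perm.isCycle_swap hap).cycleType]
    rw [Equiv.Perm.card_support_swap hap] at hle ⊢
    simp at hle ⊢
    omega
  · set c := σ.cycleOf p with hc
    have hcyc : c.IsCycle := Equiv.Perm.isCycle_cycleOf σ hp
    have hd : (σ * c⁻¹).Disjoint c :=
      Equiv.Perm.disjoint_mul_inv_of_mem_cycleFactorsFinset
        (Equiv.Perm.cycleOf_mem_cycleFactorsFinset_iff.2 (Equiv.Perm.mem_support.2 hp))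
    set r := σ * c⁻¹ with hr
    have hcp : c p ≠ p := by rw [hc, Equiv.Perm.cycleOf_apply_self]; exact hp
    have hca : c a = a := by
      rw [hc]
      by_cases h : σ.SameCycle p a
      · rw [h.cycleOf_apply, ha]
      · exact Equiv.Perm.cycleOf_apply_of_not_sameCycle h
    have hσ : σ = c * r := by rw [← hd.commute.eq, hr]; simp
    have hra : r a = a := by
      have := congrArg (fun τ => τ a) (hd.commute.eq.trans hσ.symm)
      simpa [hca, ha] using this
    obtain ⟨h1, h2⟩ := isCycle_swap_mul hcyc hcp hca
    have hd' : (Equiv.swap a p * c).Disjoint r := by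
      rw [Equiv.Perm.disjoint_iff_disjoint_support, h2, Finset.disjoint_insert_left]
      exact ⟨by simp [hra], (Equiv.Perm.disjoint_iff_disjoint_support.1 hd).symm⟩
    have hle := Finset.card_le_univ (Equiv.swap a p * σ).support
    rw [hσ, ← mul_assoc, hd'.card_support_mul, h2, Finset.card_insert_of_notMem (by simp [hca])]
      at hle
    rw [hσ, ← mul_assoc, hd'.cycleType_mul, hd.symm.cycleType_mul, hd'.card_support_mul,
      hd.symm.card_support_mul, h1.cycleType, hcyc.cycleType, h2,
      Finset.card_insert_of_notMem (by simp [hca])]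
    simp at hle ⊢
    omega

theorem numCycles_decomposeFin_symm_succ {n : ℕ} (p : Fin n) (e : Equiv.Perm (Fin n)) :
    numCycles (Equiv.Perm.decomposeFin.symm (p.succ, e)) = numCycles e := by
  have h := numCycles_swap_mul (σ := Equiv.Perm.decomposeFin.symm (0, e)) (a := 0)
    (p := p.succ) (Fin.succ_ne_zero p).symm (by simp)
  rw [← decomposeFin_symm_eq_swap_mul, numCycles_decomposeFin_symm_zero] at h
  omega

/-! ### The multivariate Eulerian polynomial and its zeros -/

/-- The weight of the arc `i ↦ σ i`: a weak exceedance carries the variable `x i` of its source, an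
anti-exceedance the variable `y (σ i)` of its target. -/
def arcWeight {n : ℕ} (x y : Fin n → ℂ) (σ : Equiv.Perm (Fin n)) (i : Fin n) : ℂ :=
  if i ≤ σ i then x i else y (σ i)

/-- The multivariate Eulerian polynomial with cycle parameter `θ`. -/
def eulerianSum (θ : ℝ) {n : ℕ} (x y : Fin n → ℂ) : ℂ :=
  ∑ σ : Equiv.Perm (Fin n), (θ : ℂ) ^ numCycles σ * ∏ i, arcWeight x y σ i

/-- The polynomial `t ↦ eulerianSum θ (x + t) (y + t)`. -/
noncomputable def eulerianPoly (θ : ℝ) {n : ℕ} (x y : Fin n → ℂ) : Polynomial ℂ :=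
  ∑ σ : Equiv.Perm (Fin n), Polynomial.C ((θ : ℂ) ^ numCycles σ) *
    ∏ i, (Polynomial.X + Polynomial.C (arcWeight x y σ i))

theorem eval_eulerianPoly (θ : ℝ) {n : ℕ} (x y : Fin n → ℂ) (t : ℂ) :
    (eulerianPoly θ x y).eval t = eulerianSum θ (fun i => t + x i) (fun i => t + y i) := by
  simp only [eulerianPoly, eulerianSum, Polynomial.eval_finsetSum, Polynomial.eval_mul,
    Polynomial.eval_C, Polynomial.eval_prod, Polynomial.eval_add, Polynomial.eval_X]
  refine Finset.sum_congr rfl fun σ _ => ?_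
  congr 1
  refine Finset.prod_congr rfl fun i _ => ?_
  unfold arcWeight
  split_ifs <;> rfl

theorem eval_zero_eulerianPoly (θ : ℝ) {n : ℕ} (x y : Fin n → ℂ) :
    (eulerianPoly θ x y).eval 0 = eulerianSum θ x y := by
  rw [eval_eulerianPoly]
  simp

theorem eval_zero_derivative_eulerianPoly (θ : ℝ) {n : ℕ} (x y : Fin n → ℂ) :
    (eulerianPoly θ x y).derivative.eval 0 = ∑ σ : Equiv.Perm (Fin n),
      (θ : ℂ) ^ numCycles σ * ∑ j, ∏ i ∈ Finset.univ.erase j, arcWeight x y σ i := by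
  simp [eulerianPoly, -map_pow, Polynomial.derivative_mul,
    Polynomial.derivative_prod_finset, Polynomial.eval_finsetSum, Polynomial.eval_prod]

theorem prod_arcWeight_zero {n : ℕ} (x y : Fin (n + 1) → ℂ) (e : Equiv.Perm (Fin n)) :
    ∏ i, arcWeight x y (Equiv.Perm.decomposeFin.symm (0, e)) i =
      x 0 * ∏ i, arcWeight (fun i => x i.succ) (fun i => y i.succ) e i := by
  rw [Fin.prod_univ_succ]
  simp [arcWeight]

/-- Inserting `0` cuts the arc `j → e j` into an anti-exceedance into `0`, of weight `y 0`, and an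
exceedance out of `0`, of weight `x 0`. -/
theorem prod_arcWeight_succ {n : ℕ} (x y : Fin (n + 1) → ℂ) (e : Equiv.Perm (Fin n))
    (j : Fin n) :
    ∏ i, arcWeight x y (Equiv.Perm.decomposeFin.symm ((e j).succ, e)) i =
      x 0 * y 0 * ∏ i ∈ Finset.univ.erase j,
        arcWeight (fun i => x i.succ) (fun i => y i.succ) e i := by
  rw [Fin.prod_univ_succ, ← Finset.mul_prod_erase Finset.univ _ (Finset.mem_univ j), ← mul_assoc]
  congr 1
  · simp [arcWeight]
  · refine Finset.prod_congr rfl fun i hi => ?_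
    have hij : e i ≠ e j := fun h => (Finset.mem_erase.1 hi).1 (e.injective h)
    have : Equiv.Perm.decomposeFin.symm ((e j).succ, e) i.succ = (e i).succ := by
      rw [Equiv.Perm.decomposeFin_symm_apply_succ]
      exact Equiv.swap_apply_of_ne_of_ne (Fin.succ_ne_zero _) (by simpa using hij)
    simp [arcWeight, this]

theorem eulerianSum_succ (θ : ℝ) {n : ℕ} (x y : Fin (n + 1) → ℂ) :
    eulerianSum θ x y =
      θ * x 0 * eulerianSum θ (fun i => x i.succ) (fun i => y i.succ) +
      x 0 * y 0 * (eulerianPoly θ (fun i => x i.succ) (fun i => y i.succ)).derivative.eval 0 := by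
  rw [eval_zero_derivative_eulerianPoly, eulerianSum,
    ← Equiv.sum_comp Equiv.Perm.decomposeFin.symm, Fintype.sum_prod_type, Fin.sum_univ_succ,
    eulerianSum, Finset.mul_sum, Finset.mul_sum]
  congr 1
  · refine Finset.sum_congr rfl fun e _ => ?_
    rw [numCycles_decomposeFin_symm_zero, prod_arcWeight_zero]
    ring
  · rw [Finset.sum_comm]
    refine Finset.sum_congr rfl fun e _ => ?_
    -- Indexing by the source `j` of the cut arc, rather than its target `e j`, matches the terms of
    -- the derivative.
    rw [← Equiv.sum_comp e, Finset.mul_sum, Finset.mul_sum]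
    refine Finset.sum_congr rfl fun j _ => ?_
    rw [numCycles_decomposeFin_symm_succ, prod_arcWeight_succ]
    ring

/-- The logarithmic derivative of a polynomial without zeros in a half-plane. -/
theorem re_derivative_div_eval_nonneg {p : Polynomial ℂ} {x : ℂ}
    (h : ∀ z : ℂ, x.re ≤ z.re → p.eval z ≠ 0) :
    0 ≤ (p.derivative.eval x / p.eval x).re := by
  -- The quotient is the sum of `1 / (x - r)` over the roots `r`, all strictly to the left of `x`.
  rw [(IsAlgClosed.splits p).eval_derivative_div_eval_of_ne_zero (h x le_rfl)]
  rw [← Complex.reCLM_apply, map_multiset_sum]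
  refine Multiset.sum_nonneg fun r hr => ?_
  simp only [Multiset.map_map, Multiset.mem_map, Function.comp] at hr
  obtain ⟨z, hz, rfl⟩ := hr
  have hz0 : p.eval z = 0 := (Polynomial.mem_roots'.1 hz).2
  have hlt : z.re < x.re := by
    by_contra hcon
    exact h z (not_lt.1 hcon) hz0
  simp only [Complex.reCLM_apply, one_div, Complex.inv_re, Complex.sub_re]
  exact div_nonneg (sub_nonneg.2 hlt.le) (Complex.normSq_nonneg _)

theorem eulerianSum_ne_zero {θ : ℝ} (hθ : 0 < θ) {n : ℕ} (x y : Fin n → ℂ)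
    (hx : ∀ i, 0 < (x i).re) (hy : ∀ i, 0 < (y i).re) : eulerianSum θ x y ≠ 0 := by
  induction n with
  | zero => simp [eulerianSum, hθ.ne']
  | succ n ih =>
    set x' : Fin n → ℂ := fun i => x i.succ
    set y' : Fin n → ℂ := fun i => y i.succ
    have hV : eulerianSum θ x' y' ≠ 0 := ih x' y' (fun i => hx _) (fun i => hy _)
    -- Translating all variables by `z` with `0 ≤ z.re` preserves the half-plane, so the induction
    -- hypothesis excludes roots there.
    have hre := re_derivative_div_eval_nonneg (p := eulerianPoly θ x' y') (x := 0) (by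
      intro z hz
      rw [eval_eulerianPoly]
      rw [Complex.zero_re] at hz
      refine ih _ _ (fun i => ?_) (fun i => ?_)
      · have := hx i.succ
        simp only [Complex.add_re, x']
        linarith
      · have := hy i.succ
        simp only [Complex.add_re, y']
        linarith)
    rw [eval_zero_eulerianPoly] at hre
    have hx0 : x 0 ≠ 0 := fun h => by simpa [h] using hx 0
    have hy0 : y 0 ≠ 0 := fun h => by simpa [h] using hy 0
    have hfac : eulerianSum θ x y = x 0 * y 0 * eulerianSum θ x' y' *
        (θ / y 0 + (eulerianPoly θ x' y').derivative.eval 0 / eulerianSum θ x' y') := by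
      rw [eulerianSum_succ]
      field_simp
      rfl
    rw [hfac]
    refine mul_ne_zero (mul_ne_zero (mul_ne_zero hx0 hy0) hV) fun h => ?_
    have h2 := congrArg Complex.re h
    have h3 : 0 < ((θ : ℂ) / y 0).re := by
      rw [div_eq_mul_inv, Complex.re_ofReal_mul, Complex.inv_re]
      exact mul_pos hθ (div_pos (hy 0) (Complex.normSq_pos.2 hy0))
    rw [Complex.add_re, Complex.zero_re] at h2
    linarith

theorem eulerianSum_one (θ : ℝ) (n : ℕ) :
    eulerianSum θ (fun _ : Fin n => 1) (fun _ => 1) = ∏ i ∈ Finset.range n, ((θ : ℂ) + i) := by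
  induction n with
  | zero => simp [eulerianSum, numCycles_eq]
  | succ n ih =>
    rw [eulerianSum_succ, Finset.prod_range_succ, ← ih, eval_zero_derivative_eulerianPoly]
    simp only [arcWeight, ite_self, eulerianSum, Finset.prod_const_one, Finset.sum_const,
      Finset.card_univ, Fintype.card_fin, nsmul_eq_mul, mul_one, ← Finset.sum_mul, one_mul]
    ring

/-! ### Holomorphic logarithms and Cauchy estimates -/

/-- A zero-free holomorphic function on a disc has a holomorphic logarithm. -/
theorem exists_differentiableOn_exp_eq {φ : ℂ → ℂ} {R : ℝ} (hR : 0 < R)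
    (hd : DifferentiableOn ℂ φ (Metric.ball 0 R)) (h0 : ∀ z ∈ Metric.ball 0 R, φ z ≠ 0)
    (h1 : φ 0 = 1) :
    ∃ g : ℂ → ℂ, DifferentiableOn ℂ g (Metric.ball 0 R) ∧ g 0 = 0 ∧
      ∀ z ∈ Metric.ball 0 R, Complex.exp (g z) = φ z := by
  have hq : DifferentiableOn ℂ (fun z => deriv φ z / φ z) (Metric.ball 0 R) :=
    (hd.deriv Metric.isOpen_ball).div hd h0
  obtain ⟨g, hg0, hg⟩ := hq.isExactOn_ball.with_val_at 0 0
  refine ⟨g, fun z hz => (hg z hz).differentiableAt.differentiableWithinAt, hg0, fun z hz => ?_⟩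
  have hder : ∀ w ∈ Metric.ball (0 : ℂ) R,
      HasDerivAt (fun w => φ w * Complex.exp (-g w)) 0 w := by
    intro w hw
    have hφ : HasDerivAt φ (deriv φ w) w :=
      (hd.differentiableAt (Metric.isOpen_ball.mem_nhds hw)).hasDerivAt
    have h := hφ.mul (hg w hw).neg.cexp
    have e : deriv φ w * Complex.exp (-g w) +
        φ w * (Complex.exp (-g w) * -(deriv φ w / φ w)) = 0 := by
      have := h0 w hw
      field_simp
      ring
    exact e ▸ h
  have hc := Metric.isOpen_ball.is_const_of_deriv_eq_zero
    (convex_ball (0 : ℂ) R).isPreconnected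
    (fun w hw => (hder w hw).differentiableAt.differentiableWithinAt)
    (fun w hw => (hder w hw).deriv) hz (Metric.mem_ball_self hR)
  simp only [h1, hg0, neg_zero, Complex.exp_zero, mul_one] at hc
  rw [Complex.exp_neg] at hc
  field_simp at hc
  exact hc.symm

theorem iteratedDeriv_re_comp_ofReal {g : ℂ → ℂ} {R : ℝ}
    (hg : DifferentiableOn ℂ g (Metric.ball 0 R)) (n : ℕ) :
    ∀ s : ℝ, (s : ℂ) ∈ Metric.ball (0 : ℂ) R →
      iteratedDeriv n (fun s : ℝ => (g s).re) s = (iteratedDeriv n g s).re := by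
  induction n with
  | zero => simp
  | succ n ih =>
    intro s hs
    rw [iteratedDeriv_succ, iteratedDeriv_succ]
    have hev : iteratedDeriv n (fun s : ℝ => (g s).re) =ᶠ[nhds s]
        fun s : ℝ => (iteratedDeriv n g s).re := by
      have : ∀ᶠ r : ℝ in nhds s, (r : ℂ) ∈ Metric.ball (0 : ℂ) R :=
        Complex.continuous_ofReal.continuousAt.eventually (Metric.isOpen_ball.mem_nhds hs)
      exact this.mono ih
    rw [hev.deriv_eq]
    have ha : DifferentiableAt ℂ (iteratedDeriv n g) s := by
      rw [iteratedDeriv_eq_iterate]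
      exact ((hg.analyticOnNhd Metric.isOpen_ball).iterated_deriv n s hs).differentiableAt
    exact (ha.hasDerivAt.real_of_complex).deriv

/-- Derivatives of the logarithm of a zero-free holomorphic function with bounded growth. -/
theorem abs_iteratedDeriv_log_norm_le {φ : ℂ → ℂ} {R M : ℝ} (hR : 0 < R) (hM : 0 < M)
    (hd : DifferentiableOn ℂ φ (Metric.ball 0 R)) (h0 : ∀ z ∈ Metric.ball 0 R, φ z ≠ 0)
    (h1 : φ 0 = 1) (hb : ∀ z ∈ Metric.ball 0 R, ‖φ z‖ ≤ Real.exp M) (n : ℕ) :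
    |iteratedDeriv n (fun s : ℝ => Real.log ‖φ s‖) 0| ≤
      n.factorial * (2 * M) / (R / 2) ^ n := by
  obtain ⟨g, hg, hg0, hexp⟩ := exists_differentiableOn_exp_eq hR hd h0 h1
  have hlog : ∀ z ∈ Metric.ball (0 : ℂ) R, Real.log ‖φ z‖ = (g z).re := by
    intro z hz
    rw [← hexp z hz, Complex.norm_exp, Real.log_exp]
  have hmem : (((0 : ℝ) : ℂ)) ∈ Metric.ball (0 : ℂ) R := by simpa using hR
  have hev : (fun s : ℝ => Real.log ‖φ s‖) =ᶠ[nhds 0] fun s : ℝ => (g s).re := by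
    have : ∀ᶠ r : ℝ in nhds 0, (r : ℂ) ∈ Metric.ball (0 : ℂ) R :=
      Complex.continuous_ofReal.continuousAt.eventually (Metric.isOpen_ball.mem_nhds hmem)
    exact this.mono fun r hr => hlog r hr
  rw [hev.iteratedDeriv_eq, iteratedDeriv_re_comp_ofReal hg n 0 hmem]
  refine (Complex.abs_re_le_norm _).trans ?_
  rw [Complex.ofReal_zero]
  have hhalf : R / 2 < R := by linarith
  refine Complex.norm_iteratedDeriv_le_of_forall_mem_sphere_norm_le n (by positivity) ?_ ?_
  · refine DifferentiableOn.diffContOnCl (hg.mono ?_)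
    exact Metric.closure_ball_subset_closedBall.trans (Metric.closedBall_subset_ball hhalf)
  · intro z hz
    have hzn : ‖z‖ = R / 2 := by simpa using hz
    have hzR : z ∈ Metric.ball (0 : ℂ) R := by simp [hzn, hR]
    -- The bound `2 * M * r / (R - r)` equals `2 * M` at `r = R / 2`.
    have := Complex.borelCaratheodory_zero hM hg (fun w hw => by
      have h2 := hb w hw
      rw [← hexp w hw, Complex.norm_exp, Real.exp_le_exp] at h2
      exact h2) hR hzR hg0
    rw [hzn] at this
    refine this.trans (le_of_eq ?_)
    field_simp
    ring

/-! ### Mixed derivatives from directional ones -/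

/-- The polarization identity: a symmetric multilinear map is determined by its diagonal. -/
theorem MultilinearMap.sum_powerset_diagonal {R M N : Type*} [CommRing R] [AddCommGroup M]
    [Module R M] [AddCommGroup N] [Module R N] {n : ℕ}
    (f : MultilinearMap R (fun _ : Fin n => M) N) (v : Fin n → M)
    (hf : ∀ τ : Equiv.Perm (Fin n), f (v ∘ τ) = f v) :
    ∑ s : Finset (Fin n), (-1 : ℤ) ^ (sᶜ).card • f (fun _ => ∑ j ∈ s, v j) =
      n.factorial • f v := by
  have h1 : ∀ s : Finset (Fin n), f (fun _ => ∑ j ∈ s, v j) =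
      ∑ r : Fin n → Fin n, if Finset.univ.image r ⊆ s then f (v ∘ r) else 0 := by
    intro s
    rw [f.map_sum_finset (fun _ => v) (fun _ => s), ← Finset.sum_filter]
    refine Finset.sum_congr ?_ fun r _ => rfl
    ext r
    simp [Fintype.mem_piFinset, Finset.subset_iff]
  simp_rw [h1, Finset.smul_sum]
  rw [Finset.sum_comm]
  -- The alternating sum over the sets `s` containing the image of `r` vanishes unless `r` is onto,
  -- hence a permutation.
  have h2 : ∀ r : Fin n → Fin n, ∑ s : Finset (Fin n),
      (-1 : ℤ) ^ (sᶜ).card • (if Finset.univ.image r ⊆ s then f (v ∘ r) else 0) =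
      if Function.Bijective r then f v else 0 := by
    intro r
    have h3 : ∑ s : Finset (Fin n),
        (-1 : ℤ) ^ (sᶜ).card • (if Finset.univ.image r ⊆ s then f (v ∘ r) else 0) =
        (∑ s ∈ ((Finset.univ.image r)ᶜ).powerset, (-1 : ℤ) ^ s.card) • f (v ∘ r) := by
      simp only [smul_ite, smul_zero]
      rw [← Finset.sum_filter, Finset.sum_smul]
      refine Finset.sum_nbij' (fun s => sᶜ) (fun s => sᶜ) (fun s hs => ?_) (fun s hs => ?_)
        (fun s _ => compl_compl s) (fun s _ => compl_compl s) (fun _ _ => rfl)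
      · rw [Finset.mem_powerset, Finset.compl_subset_compl]
        exact (Finset.mem_filter.1 hs).2
      · rw [Finset.mem_filter]
        exact ⟨Finset.mem_univ _, Finset.subset_compl_comm.1 (Finset.mem_powerset.1 hs)⟩
    rw [h3, Finset.sum_powerset_neg_one_pow_card]
    by_cases hr : Function.Bijective r
    · have h4 : (Finset.univ.image r)ᶜ = ∅ := by
        rw [Finset.image_univ_of_surjective hr.2, Finset.compl_univ]
      rw [if_pos h4, if_pos hr, one_smul]
      exact hf (Equiv.ofBijective r hr)
    · have h4 : (Finset.univ.image r)ᶜ ≠ ∅ := by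
        intro h
        refine hr (Finite.surjective_iff_bijective.1 fun b => ?_)
        have : b ∈ Finset.univ.image r := by
          rw [(Finset.compl_eq_empty_iff _).1 h]; exact Finset.mem_univ b
        simpa using this
      rw [if_neg h4, if_neg hr, zero_smul]
  simp_rw [h2]
  rw [← Finset.sum_filter, Finset.sum_const]
  congr 1
  let E : Equiv.Perm (Fin n) ≃ {r : Fin n → Fin n // Function.Bijective r} :=
    { toFun := fun τ => ⟨τ, τ.bijective⟩
      invFun := fun r => Equiv.ofBijective r.1 r.2
      left_inv := fun τ => by ext; rfl
      right_inv := fun r => rfl }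
  rw [← Fintype.card_subtype, ← Fintype.card_congr E, Fintype.card_perm, Fintype.card_fin]

theorem ContDiff.iteratedFDeriv_diagonal {E : Type*} [NormedAddCommGroup E] [NormedSpace ℝ E]
    {f : E → ℝ} {n : ℕ} (hf : ContDiff ℝ n f) (v : E) :
    iteratedFDeriv ℝ n f 0 (fun _ => v) = iteratedDeriv n (fun s : ℝ => f (s • v)) 0 := by
  have h := (ContinuousLinearMap.toSpanSingleton ℝ v).iteratedFDeriv_comp_right hf 0
    (i := n) le_rfl
  have h2 : (f ∘ (ContinuousLinearMap.toSpanSingleton ℝ v)) = fun s : ℝ => f (s • v) := by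
    ext s
    simp [ContinuousLinearMap.toSpanSingleton_apply]
  rw [h2] at h
  rw [iteratedDeriv_eq_iteratedFDeriv, h]
  simp [ContinuousLinearMap.toSpanSingleton_apply]

/-- A bound of a mixed partial derivative by directional derivatives. -/
theorem abs_iteratedFDeriv_single_le {n : ℕ} {f : (Fin n → ℝ) → ℝ} (hf : ContDiff ℝ ⊤ f)
    {B : ℝ} (hB : ∀ s : Finset (Fin n),
      |iteratedDeriv n (fun r : ℝ => f (r • ∑ j ∈ s, Pi.single j (1 : ℝ))) 0| ≤ B) :
    |iteratedFDeriv ℝ n f 0 (fun i => Pi.single i (1 : ℝ))| ≤ 2 ^ n * B := by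
  have h := (iteratedFDeriv ℝ n f 0).toMultilinearMap.sum_powerset_diagonal
    (fun i => Pi.single i (1 : ℝ)) (fun τ => hf.contDiffAt.iteratedFDeriv_comp_perm _ τ)
  simp only [ContinuousMultilinearMap.coe_coe] at h
  have h1 : |(n.factorial : ℝ) * iteratedFDeriv ℝ n f 0 (fun i => Pi.single i (1 : ℝ))| ≤
      2 ^ n * B := by
    rw [← nsmul_eq_mul, ← h]
    refine (Finset.abs_sum_le_sum_abs _ _).trans ?_
    refine (Finset.sum_le_card_nsmul _ _ B fun s _ => ?_).trans (by simp)
    rw [(hf.of_le le_top).iteratedFDeriv_diagonal]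
    simpa [abs_mul] using hB s
  refine le_trans ?_ h1
  rw [abs_mul]
  refine le_mul_of_one_le_left (abs_nonneg _) ?_
  rw [Nat.abs_cast]
  exact_mod_cast n.factorial_pos

/-! ### Exponential moments of weak exceedances -/

theorem ewensWeight_pos {θ : ℝ} (hθ : 0 < θ) {N : ℕ} (σ : Equiv.Perm (Fin N)) :
    0 < ewensWeight θ σ :=
  div_pos (pow_pos hθ _) (Finset.prod_pos fun i _ => by positivity)

instance permMeasurableSingletonClass (N : ℕ) : MeasurableSingletonClass (Equiv.Perm (Fin N)) :=
  ⟨fun _ => trivial⟩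

theorem integral_ewensMeasure {θ : ℝ} (hθ : 0 < θ) {N : ℕ} (h : Equiv.Perm (Fin N) → ℝ) :
    ∫ σ, h σ ∂(ewensMeasure θ N) = ∑ σ, ewensWeight θ σ * h σ := by
  have hi : ∀ σ : Equiv.Perm (Fin N),
      Integrable h (ENNReal.ofReal (ewensWeight θ σ) • Measure.dirac σ) := fun σ =>
    (integrable_dirac (by simp)).smul_measure ENNReal.ofReal_ne_top
  rw [ewensMeasure, integral_finsetSum_measure fun σ _ => hi σ]
  refine Finset.sum_congr rfl fun σ _ => ?_
  rw [integral_smul_measure, integral_dirac, ENNReal.toReal_ofReal (ewensWeight_pos hθ σ).le,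
    smul_eq_mul]

/-- The coefficient of `excInd σ i` in `N * excF σ x`. -/
noncomputable def excCoeff {N : ℕ} (x : ℝ) (i : Fin N) : ℝ :=
  if (i : ℕ) < ⌊(N : ℝ) * x⌋₊ then 1 else
    if (i : ℕ) < ⌊(N : ℝ) * x⌋₊ + 1 then (N : ℝ) * x - (⌊(N : ℝ) * x⌋₊ : ℝ) else 0

theorem excF_eq_sum {N : ℕ} (σ : Equiv.Perm (Fin N)) (x : ℝ) :
    excF σ x = ∑ i, excCoeff x i / N * excInd σ i := by
  simp only [excF, excCount, Finset.sum_filter]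
  rw [← Finset.sum_sub_distrib, Finset.mul_sum, ← Finset.sum_add_distrib, Finset.sum_div]
  refine Finset.sum_congr rfl fun i _ => ?_
  unfold excCoeff
  by_cases h : (i : ℕ) < ⌊(N : ℝ) * x⌋₊
  · have h' : (i : ℕ) < ⌊(N : ℝ) * x⌋₊ + 1 := by omega
    simp only [h, h', if_true]
    ring
  · simp only [h, if_false]
    split_ifs <;> ring

theorem excCoeff_mem_Icc {N : ℕ} {x : ℝ} (hx : 0 ≤ x) (i : Fin N) :
    excCoeff x i ∈ Set.Icc (0 : ℝ) 1 := by
  have h0 : (0 : ℝ) ≤ N * x := by positivity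
  have h1 := Nat.floor_le h0
  have h2 := (Nat.lt_floor_add_one ((N : ℝ) * x)).le
  unfold excCoeff
  split_ifs <;> constructor <;> linarith

/-- The exponential moment `E (exp (∑ i, z b_i A_i))`, where `A_i` is the indicator of a weak
exceedance at `i`. -/
noncomputable def excMoment (θ : ℝ) {N : ℕ} (b : Fin N → ℝ) (z : ℂ) : ℂ :=
  ∑ σ : Equiv.Perm (Fin N), (ewensWeight θ σ : ℂ) *
    Complex.exp (z * ((∑ i, b i * excInd σ i : ℝ) : ℂ))

theorem excMoment_eq_eulerianSum (θ : ℝ) {N : ℕ} (b : Fin N → ℝ) (z : ℂ) :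
    excMoment θ b z = eulerianSum θ (fun i => Complex.exp (z * b i)) (fun _ => 1) /
      ∏ i ∈ Finset.range N, ((θ : ℂ) + i) := by
  rw [eulerianSum, Finset.sum_div, excMoment]
  refine Finset.sum_congr rfl fun σ _ => ?_
  have h : Complex.exp (z * ((∑ i, b i * excInd σ i : ℝ) : ℂ)) =
      ∏ i, arcWeight (fun i => Complex.exp (z * b i)) (fun _ => 1) σ i := by
    rw [Complex.ofReal_sum, Finset.mul_sum, Complex.exp_sum]
    refine Finset.prod_congr rfl fun i _ => ?_
    unfold arcWeight excInd
    split_ifs <;> simp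
  rw [h, ewensWeight]
  push_cast
  ring

theorem prod_add_ne_zero {θ : ℝ} (hθ : 0 < θ) (N : ℕ) :
    ∏ i ∈ Finset.range N, ((θ : ℂ) + i) ≠ 0 := by
  refine Finset.prod_ne_zero_iff.2 fun i _ => ?_
  have : (θ : ℝ) + i ≠ 0 := by positivity
  exact_mod_cast this

theorem excMoment_zero {θ : ℝ} (hθ : 0 < θ) {N : ℕ} (b : Fin N → ℝ) : excMoment θ b 0 = 1 := by
  rw [excMoment_eq_eulerianSum]
  simp only [zero_mul, Complex.exp_zero]
  rw [eulerianSum_one, div_self (prod_add_ne_zero hθ N)]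

theorem sum_ewensWeight {θ : ℝ} (hθ : 0 < θ) (N : ℕ) :
    ∑ σ : Equiv.Perm (Fin N), ewensWeight θ σ = 1 := by
  have h := excMoment_zero hθ (N := N) 0
  simp only [excMoment, zero_mul, Complex.exp_zero, mul_one] at h
  exact_mod_cast h

theorem excMoment_ne_zero {θ : ℝ} (hθ : 0 < θ) {N : ℕ} {b : Fin N → ℝ} {z : ℂ}
    (hb : ∀ i, ‖z‖ * |b i| ≤ 1) : excMoment θ b z ≠ 0 := by
  rw [excMoment_eq_eulerianSum]
  refine div_ne_zero (eulerianSum_ne_zero hθ _ _ (fun i => ?_) (fun _ => by simp))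
    (prod_add_ne_zero hθ N)
  rw [Complex.exp_re]
  refine mul_pos (Real.exp_pos _) (Real.cos_pos_of_mem_Ioo ?_)
  -- Since `1 < π / 2`, `exp (z * b i)` stays in the right half-plane.
  have h1 : |(z * b i).im| ≤ 1 := by
    refine (Complex.abs_im_le_norm _).trans ?_
    rw [norm_mul, Complex.norm_real, Real.norm_eq_abs]
    exact hb i
  have h2 := abs_le.1 h1
  have h3 := Real.pi_gt_three
  constructor <;> linarith

theorem norm_excMoment_le {θ : ℝ} (hθ : 0 < θ) {N : ℕ} {b : Fin N → ℝ} {z : ℂ}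
    (hb : ∀ i, ‖z‖ * |b i| ≤ 1) : ‖excMoment θ b z‖ ≤ Real.exp N := by
  rw [← one_mul (Real.exp N), ← sum_ewensWeight hθ N, Finset.sum_mul]
  refine norm_sum_le_of_le _ fun σ _ => ?_
  rw [norm_mul, Complex.norm_real, Real.norm_of_nonneg (ewensWeight_pos hθ σ).le,
    Complex.norm_exp]
  refine mul_le_mul_of_nonneg_left (Real.exp_le_exp.2 ?_) (ewensWeight_pos hθ σ).le
  refine (Complex.re_le_norm _).trans ?_
  rw [norm_mul, Complex.norm_real, Real.norm_eq_abs]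
  calc ‖z‖ * |∑ i, b i * excInd σ i| ≤ ‖z‖ * ∑ i, |b i * excInd σ i| := by
        gcongr
        exact Finset.abs_sum_le_sum_abs _ _
    _ = ∑ i, ‖z‖ * |b i * excInd σ i| := Finset.mul_sum _ _ _
    _ ≤ ∑ _i : Fin N, (1 : ℝ) := by
        refine Finset.sum_le_sum fun i _ => ?_
        unfold excInd
        split_ifs
        · simpa using hb i
        · simp
    _ = N := by simp

theorem differentiable_excMoment (θ : ℝ) {N : ℕ} (b : Fin N → ℝ) :
    Differentiable ℂ (excMoment θ b) := by
  unfold excMoment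
  fun_prop

/-- On the real axis the moment is positive, so its norm can stand inside the real logarithm
defining cumulants. -/
theorem norm_excMoment_ofReal {θ : ℝ} (hθ : 0 < θ) {N : ℕ} (b : Fin N → ℝ) (s : ℝ) :
    ‖excMoment θ b s‖ = ∑ σ : Equiv.Perm (Fin N), ewensWeight θ σ *
      Real.exp (s * ∑ i, b i * excInd σ i) := by
  have h : excMoment θ b s = ((∑ σ : Equiv.Perm (Fin N), ewensWeight θ σ *
      Real.exp (s * ∑ i, b i * excInd σ i) : ℝ) : ℂ) := by
    simp [excMoment]
  rw [h, Complex.norm_real, Real.norm_of_nonneg]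
  exact Finset.sum_nonneg fun σ _ => mul_nonneg (ewensWeight_pos hθ σ).le (Real.exp_pos _).le

theorem proposition5p3 (θ : ℝ) (hθ : 0 < θ) (ℓ : ℕ) (hℓ : 1 ≤ ℓ) :
    ∃ C : ℝ, ∀ N : ℕ, 1 ≤ N → ∀ x : Fin ℓ → ℝ, (∀ j, x j ∈ Set.Icc (0 : ℝ) 1) →
      |jointCumulant (ewensMeasure θ N) (fun j σ => excF σ (x j))| ≤
        C * (N : ℝ) ^ (-(ℓ : ℤ) + 1) := by
  -- The factor `2 ^ ℓ` counts the subsets in the polarization; the rest is the Cauchy bound with `R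
  -- = N / ℓ` and `M = N`.
  refine ⟨2 ^ ℓ * (ℓ.factorial * 2 * (2 * ℓ) ^ ℓ), fun N hN x hx => ?_⟩
  have hN0 : (0 : ℝ) < N := by exact_mod_cast hN
  have hℓ0 : (0 : ℝ) < ℓ := by exact_mod_cast hℓ
  have hbound : 2 ^ ℓ * (ℓ.factorial * 2 * (2 * ℓ) ^ ℓ) * (N : ℝ) ^ (-(ℓ : ℤ) + 1) =
      2 ^ ℓ * (ℓ.factorial * (2 * N) / (N / ℓ / 2) ^ ℓ) := by
    rw [zpow_add₀ hN0.ne', zpow_neg, zpow_natCast, zpow_one, div_div, div_pow]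
    field_simp
  rw [hbound, jointCumulant]
  simp_rw [integral_ewensMeasure hθ]
  refine abs_iteratedFDeriv_single_le ?_ fun s => ?_
  · refine ContDiff.log ?_ fun t => (Finset.sum_pos (fun σ _ =>
      mul_pos (ewensWeight_pos hθ σ) (Real.exp_pos _)) Finset.univ_nonempty).ne'
    fun_prop
  -- `b` collects the coefficients of `∑ j ∈ s, F (x j)` in the exceedance indicators.
  · set b : Fin N → ℝ := fun i => (∑ j ∈ s, excCoeff (x j) i) / N with hb
    have hbi : ∀ i, |b i| ≤ ℓ / N := by
      intro i
      have h1 : 0 ≤ ∑ j ∈ s, excCoeff (x j) i :=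
        Finset.sum_nonneg fun j _ => (excCoeff_mem_Icc (hx j).1 i).1
      have h2 : ∑ j ∈ s, excCoeff (x j) i ≤ ℓ := by
        refine (Finset.sum_le_card_nsmul _ _ 1 fun j _ =>
          (excCoeff_mem_Icc (hx j).1 i).2).trans ?_
        have := Finset.card_le_univ s
        simp only [Fintype.card_fin] at this
        simpa using this
      rw [hb, abs_of_nonneg (div_nonneg h1 hN0.le)]
      gcongr
    have hball : ∀ z ∈ Metric.ball (0 : ℂ) (N / ℓ), ∀ i, ‖z‖ * |b i| ≤ 1 := by
      intro z hz i
      calc ‖z‖ * |b i| ≤ (N / ℓ) * (ℓ / N) :=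
            mul_le_mul (mem_ball_zero_iff.1 hz).le (hbi i) (abs_nonneg _) (by positivity)
        _ = 1 := by field_simp
    have hfun : (fun r : ℝ => Real.log (∑ σ : Equiv.Perm (Fin N), ewensWeight θ σ *
        Real.exp (∑ i, (r • ∑ j ∈ s, (Pi.single j (1 : ℝ) : Fin ℓ → ℝ)) i * excF σ (x i)))) =
        fun r : ℝ => Real.log ‖excMoment θ b r‖ := by
      funext r
      rw [norm_excMoment_ofReal hθ]
      congr 1
      refine Finset.sum_congr rfl fun σ _ => ?_
      congr 2
      have h1 : ∀ i : Fin ℓ, (∑ j ∈ s, (Pi.single j (1 : ℝ) : Fin ℓ → ℝ)) i =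
          if i ∈ s then 1 else 0 := by
        intro i
        simp [Finset.sum_apply, Pi.single_apply]
      simp only [Pi.smul_apply, smul_eq_mul, h1, mul_assoc, ← Finset.mul_sum]
      congr 1
      simp only [ite_mul, one_mul, zero_mul, Finset.sum_ite_mem, Finset.univ_inter, excF_eq_sum,
        hb, Finset.sum_div, Finset.sum_mul]
      exact Finset.sum_comm
    rw [hfun]
    exact abs_iteratedDeriv_log_norm_le (by positivity) hN0
      (differentiable_excMoment θ b).differentiableOn
      (fun z hz => excMoment_ne_zero hθ (hball z hz)) (excMoment_zero hθ b)
      (fun z hz => norm_excMoment_le hθ (hball z hz)) ℓ
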